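/- Let $n$ be a natural number and let $P_n$ be the path with vertex set $\{1,\dots,n\}$, in which $j$ and $k$ are adjacent if and only if $|j-k|=1$ (all edges have weight $1$). Put potential $1$ on the end vertices $1$ and $n$ and potential $0$ on all other vertices; that is, consider the Hamiltonian $M=A(P_n)+\Delta$, where $A(P_n)$ is the adjacency matrix and $\Delta$ is the diagonal matrix with $\Delta_{1,1}=\Delta_{n,n}=1$ and all other entries $0$. Let $U(t)=\exp(itM)$ for $t\in\mathbb{R}$. We say that $P_n$ with this potential admits pretty good vertex state transfer if there are vertices $a,b$ with linearly independent characteristic vectors $\mathbf{e}_a,\mathbf{e}_b$ (equivalently $a\neq b$), a sequence of real numbers $(t_k)$ and a complex number $\gamma$ with $|\gamma|=1$ such that $\lim_{k\to\infty}U(t_k)\mathbf{e}_a=\gamma\,\mathbf{e}_b$. Then $P_n$ with potential $1$ only at its end vertices admits pretty good vertex state transfer if and only if $n=2^k$ for some integer $k\ge 1$. Moreover, for $n\ge 2$ this path with potential is a symmetrized quotient graph of the even cycle $C_{2n}$: there is a partition of the vertex set of $C_{2n}$ into nonempty cells $V_1,\dots,V_n$ such that each vertex of $V_j$ is adjacent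 to exactly $c_{jk}$ vertices of $V_k$, with $c_{jk}$ depending only on $j$ and $k$, and $M_{j,k}=\sqrt{c_{jk}c_{kj}}$ for all $j,k$. -/

import Mathlib

open Filter Topology

noncomputable section

namespace QWalk

variable {V : Type*} [Fintype V] [DecidableEq V]

/-- The Hamiltonian `A(G) + Δ` of a simple graph `G` (all edges of weight `1`) with
potential `Δ j` at the vertex `j`. -/
def hamiltonian (G : SimpleGraph V) [DecidableRel G.Adj] (Δ : V → ℝ) : Matrix V V ℝ :=
  G.adjMatrix ℝ + Matrix.diagonal Δ

/-- The transition matrix `U(t) = exp(i t M)` of the continuous-time quantum walk with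
Hamiltonian `M`. -/
def transition (M : Matrix V V ℝ) (t : ℝ) : Matrix V V ℂ :=
  NormedSpace.exp ((Complex.I * (t : ℂ)) • M.map (fun x : ℝ => (x : ℂ)))

/-- A real pure state: a unit vector of `ℝ^V` (for the Euclidean norm). -/
def IsRealPureState (u : V → ℝ) : Prop := u ⬝ᵥ u = 1

/-- Pretty good state transfer between the real pure states `u` and `v`, with respect to the
Hamiltonian `M`: the two states are linearly independent, and `U(t_k) u` converges to `γ v`
for some sequence of real times `t_k` and some complex `γ` of modulus one. -/
def PGST (M : Matrix V V ℝ) (u v : V → ℝ) : Prop :=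
  IsRealPureState u ∧ IsRealPureState v ∧ LinearIndependent ℝ ![u, v] ∧
    ∃ (t : ℕ → ℝ) (γ : ℂ), ‖γ‖ = 1 ∧
      Tendsto (fun k => (transition M (t k)).mulVec (fun j => (u j : ℂ))) atTop
        (𝓝 (γ • fun j => (v j : ℂ)))

/-- The vertex state of `a`: its characteristic vector. -/
def vertexState (a : V) : V → ℝ := Pi.single a 1

/-- Pretty good vertex state transfer: PGST between some two vertex states. (Linear
independence of the states forces the two vertices to be distinct.) -/
def AdmitsVertexPGST (M : Matrix V V ℝ) : Prop :=
  ∃ a b : V, PGST M (vertexState a) (vertexState b)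

/-- The partition of the vertex set of `G` into the (nonempty) cells `V_j = cell⁻¹{j}` is
equitable, every vertex of `V_j` having exactly `c j k` neighbours in `V_k`, and `M` is the
adjacency matrix of the symmetrized quotient graph, with entries `√(c j k * c k j)`. -/
def IsSymmetrizedQuotient {W : Type*} [DecidableEq W] (G : SimpleGraph V) [DecidableRel G.Adj]
    (cell : V → W) (M : Matrix W W ℝ) : Prop :=
  Function.Surjective cell ∧ ∃ c : W → W → ℕ,
    (∀ (v : V) (k : W),
      (Finset.univ.filter fun w => G.Adj v w ∧ cell w = k).card = c (cell v) k) ∧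
    ∀ j k : W, M j k = Real.sqrt ((c j k : ℝ) * (c k j : ℝ))

/-- The potential equal to `1` at the two end vertices of the path `0, 1, …, n - 1` and to `0`
at all other vertices. -/
def endPotential (n : ℕ) (j : Fin n) : ℝ :=
  if (j : ℕ) = 0 ∨ (j : ℕ) + 1 = n then 1 else 0

open Classical in
/-- The Hamiltonian of the path on `n` vertices with potential `1` only at its end vertices. -/
def endPotentialPath (n : ℕ) : Matrix (Fin n) (Fin n) ℝ :=
  hamiltonian (SimpleGraph.pathGraph n) (endPotential n)

end QWalk

end

/-! The eigenvectors are v_r(j) = cos(πr(2j+1)/(2n)) (vertices j = 0, …, n-1), with eigenvalues θ_r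
= 2cos(πr/n), distinct for r < n, and reflecting the path multiplies v_r by (-1)^r. Pairing
U(t_k)e_a → γe_b with v_r gives exp(i t_k θ_r) v_r(a) → γ v_r(b). Comparing moduli at r = 1 forces b
to be the mirror image of a, so exp(i t_k θ_r) → γ(-1)^r whenever v_r(a) ≠ 0.

Necessity: an additive relation among such θ_r becomes a multiplicative relation among the limits
(`prod_phase_limits_eq_one`). If an odd prime p divides n, sums over p-th roots of unity
(`sum_pathEigenvalue_eq_zero`), together with θ_{n/2} = 0 for n even or θ_2 + θ_{n-2} = 0 for n odd,
give contradictory equations for γ.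

Sufficiency: for n = 2^(k+1), the θ_r with r < n/2 are independent over ℤ, because the relevant
cyclotomic polynomial has degree n (`eq_zero_of_sum_mul_pathEigenvalue_eq_zero`). Kronecker's
theorem then prescribes their phases, and θ_{n-r} = -θ_r settles the other half.

The quotient statement comes from folding C_{2n} by a reflection that fixes no vertex: the two edges
it flips become the end potentials. -/

namespace QWalk

/-! ### Kronecker approximation through trigonometric polynomials. -/

/-- The constant coefficient of a trigonometric polynomial is bounded by its supremum norm. -/
theorem norm_const_le_of_trigPoly_bounded {σ : Type*} (S : Finset σ) (μ : σ → ℝ)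
    (hμ : ∀ s ∈ S, μ s ≠ 0) (B : ℝ) (c₀ : ℂ) (c : σ → ℂ)
    (h : ∀ t : ℝ, ‖c₀ + ∑ s ∈ S, c s * Complex.exp (Complex.I * (t * μ s))‖ ≤ B) :
    ‖c₀‖ ≤ B := by
  classical
  induction S using Finset.induction_on generalizing c with
  | empty => simpa using h 0
  | insert a S ha ih =>
    have hμa : (μ a : ℂ) ≠ 0 := by exact_mod_cast hμ a (Finset.mem_insert_self _ _)
    -- Averaging the polynomial with its translate by π/μ_a cancels frequency μ_a, keeps the
    -- constant term and preserves the bound B.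
    refine ih (fun s hs => hμ s (Finset.mem_insert_of_mem hs))
      (fun s => c s * ((1 + Complex.exp (Complex.I * ((Real.pi / μ a : ℝ) * μ s))) / 2)) ?_
    intro t
    have key : c₀ + ∑ s ∈ S, c s * ((1 + Complex.exp (Complex.I * ((Real.pi / μ a : ℝ) * μ s))) / 2)
          * Complex.exp (Complex.I * (t * μ s)) =
        ((c₀ + ∑ s ∈ insert a S, c s * Complex.exp (Complex.I * (t * μ s))) +
         (c₀ + ∑ s ∈ insert a S,
            c s * Complex.exp (Complex.I * ((t + Real.pi / μ a : ℝ) * μ s)))) / 2 := by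
      have hsplit : ∀ s, Complex.exp (Complex.I * ((t + Real.pi / μ a : ℝ) * μ s)) =
          Complex.exp (Complex.I * (t * μ s)) *
            Complex.exp (Complex.I * ((Real.pi / μ a : ℝ) * μ s)) := by
        intro s
        rw [← Complex.exp_add]
        push_cast
        ring_nf
      have ha1 : Complex.exp (Complex.I * ((Real.pi / μ a : ℝ) * μ a)) = -1 := by
        rw [← Complex.exp_pi_mul_I]
        push_cast
        field_simp
      simp_rw [hsplit]
      rw [Finset.sum_insert ha, Finset.sum_insert ha, ha1]
      have : ∀ x y z w u : ℂ, (x + (u * y + z) + (x + (u * (y * -1) + w))) / 2 = x + (z + w) / 2 := by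
        intros; ring
      rw [this, ← Finset.sum_add_distrib, Finset.sum_div]
      congr 1
      refine Finset.sum_congr rfl fun s _ => ?_
      ring
    rw [key, norm_div, Complex.norm_ofNat, div_le_iff₀ two_pos]
    refine (norm_add_le _ _).trans ?_
    linarith [h t, h (t + Real.pi / μ a)]

theorem norm_coeff_le_of_trigPoly_bounded {σ : Type*} (S : Finset σ) (μ : σ → ℝ)
    (hμ : Set.InjOn μ S) (B : ℝ) (c : σ → ℂ)
    (h : ∀ t : ℝ, ‖∑ s ∈ S, c s * Complex.exp (Complex.I * (t * μ s))‖ ≤ B) {a : σ} (ha : a ∈ S) :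
    ‖c a‖ ≤ B := by
  classical
  refine norm_const_le_of_trigPoly_bounded (S.erase a) (fun s => μ s - μ a) ?_ B (c a) c ?_
  · intro s hs h0
    exact (Finset.mem_erase.mp hs).1 (hμ (Finset.mem_erase.mp hs).2 ha (sub_eq_zero.mp h0))
  · intro t
    have key : c a + ∑ s ∈ S.erase a, c s * Complex.exp (Complex.I * (t * (μ s - μ a : ℝ))) =
        Complex.exp (-(Complex.I * (t * μ a))) *
          ∑ s ∈ S, c s * Complex.exp (Complex.I * (t * μ s)) := by
      rw [← Finset.add_sum_erase S _ ha, mul_add, Finset.mul_sum]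
      congr 1
      · rw [mul_left_comm, ← Complex.exp_add]
        simp
      · refine Finset.sum_congr rfl fun s _ => ?_
        rw [mul_left_comm (Complex.exp _), ← Complex.exp_add]
        push_cast
        ring_nf
    rw [key, norm_mul]
    have : ‖Complex.exp (-(Complex.I * (t * μ a)))‖ = 1 := by
      rw [Complex.norm_exp]
      simp
    rw [this, one_mul]
    exact h t

/-- If the frequencies of degree-`p` monomials are distinct for every `p`, then the trigonometric
polynomial `∑ aᵢ exp(i t φᵢ)` with unimodular coefficients comes arbitrarily close to its trivial
upper bound. -/
theorem card_le_of_forall_norm_trigPoly_le {ι : Type*} [Fintype ι] [DecidableEq ι] (φ : ι → ℝ)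
    (hφ : ∀ p : ℕ, Set.InjOn (fun ν : ι → ℕ => ∑ i, (ν i : ℝ) * φ i)
      (Finset.piAntidiag Finset.univ p : Finset (ι → ℕ)))
    (a : ι → ℂ) (ha : ∀ i, ‖a i‖ = 1) (B : ℝ)
    (h : ∀ t : ℝ, ‖∑ i, a i * Complex.exp (Complex.I * (t * φ i))‖ ≤ B) :
    (Fintype.card ι : ℝ) ≤ B := by
  have hB : 0 ≤ B := (norm_nonneg _).trans (h 0)
  by_contra! hlt
  set N := Fintype.card ι with hN
  have hNpos : (0 : ℝ) < N := hB.trans_lt hlt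
  -- Expand the p-th power: each multinomial coefficient is the modulus of a Fourier coefficient,
  -- hence at most B^p. They add up to N^p and there are at most (p+1)^N of them, which is
  -- impossible for large p if B < N.
  have bound : ∀ p : ℕ, (N : ℝ) ^ p ≤ ((p : ℝ) + 1) ^ N * B ^ p := by
    intro p
    have hcoef : ∀ ν ∈ (Finset.piAntidiag Finset.univ p : Finset (ι → ℕ)),
        (Nat.multinomial Finset.univ ν : ℝ) ≤ B ^ p := by
      intro ν hν
      have := norm_coeff_le_of_trigPoly_bounded
        (Finset.piAntidiag Finset.univ p : Finset (ι → ℕ)) _ (hφ p) (B ^ p)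
        (fun ν => (Nat.multinomial Finset.univ ν : ℂ) * ∏ i, a i ^ ν i) ?_ hν
      · simpa [norm_mul, norm_prod, norm_pow, ha] using this
      · intro t
        have hpow := pow_le_pow_left₀ (norm_nonneg _) (h t) p
        rw [← norm_pow, Finset.sum_pow_eq_sum_piAntidiag] at hpow
        refine le_of_eq_of_le (congrArg norm (Finset.sum_congr rfl fun ν _ => ?_)) hpow
        rw [mul_assoc]
        congr 1
        simp_rw [mul_pow]
        rw [Finset.prod_mul_distrib]
        congr 1
        simp_rw [← Complex.exp_nat_mul]
        rw [← Complex.exp_sum]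
        congr 1
        push_cast
        rw [Finset.mul_sum, Finset.mul_sum]
        exact Finset.sum_congr rfl fun i _ => by ring
    have hsum : (N : ℝ) ^ p = ∑ ν ∈ (Finset.piAntidiag Finset.univ p : Finset (ι → ℕ)),
        (Nat.multinomial Finset.univ ν : ℝ) := by
      have := Finset.sum_pow_eq_sum_piAntidiag (Finset.univ : Finset ι) (fun _ => (1 : ℝ)) p
      simpa [hN] using this
    have hcard : (Finset.piAntidiag Finset.univ p : Finset (ι → ℕ)).card ≤ (p + 1) ^ N := by
      have hsub : (Finset.piAntidiag Finset.univ p : Finset (ι → ℕ)) ⊆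
          Fintype.piFinset fun _ => Finset.range (p + 1) := by
        intro ν hν
        rw [Fintype.mem_piFinset]
        intro i
        have h1 := (Finset.mem_piAntidiag.mp hν).1
        rw [Finset.mem_range, Nat.lt_succ_iff, ← h1]
        exact Finset.single_le_sum (f := ν) (fun _ _ => Nat.zero_le _) (Finset.mem_univ i)
      simpa [hN] using Finset.card_le_card hsub
    rw [hsum]
    refine (Finset.sum_le_card_nsmul _ _ _ hcoef).trans ?_
    rw [nsmul_eq_mul]
    gcongr
    exact_mod_cast hcard
  have hr0 : 0 ≤ B / N := by positivity
  have hr1 : |B / N| < 1 := by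
    rw [abs_of_nonneg hr0, div_lt_one hNpos]
    exact hlt
  have hlim := (tendsto_pow_const_mul_const_pow_of_abs_lt_one N hr1).const_mul ((2 : ℝ) ^ N)
  rw [mul_zero] at hlim
  obtain ⟨p, hp, hp1⟩ := ((hlim.eventually (gt_mem_nhds one_pos)).and (eventually_ge_atTop 1)).exists
  have hb := bound p
  have hp1' : (1 : ℝ) ≤ p := by exact_mod_cast hp1
  have : ((p : ℝ) + 1) ^ N ≤ 2 ^ N * (p : ℝ) ^ N := by
    rw [← mul_pow]
    gcongr
    linarith
  have h3 : (N : ℝ) ^ p ≤ (2 ^ N * (p : ℝ) ^ N) * B ^ p := hb.trans (by gcongr)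
  have h4 : (2 : ℝ) ^ N * ((p : ℝ) ^ N * (B / N) ^ p) = (2 ^ N * (p : ℝ) ^ N) * B ^ p / N ^ p := by
    rw [div_pow]
    ring
  rw [h4, div_lt_one (by positivity)] at hp
  linarith

/-- Kronecker's approximation theorem: if the reals `θᵢ` are linearly independent over `ℤ`, then
the numbers `exp(i t θᵢ)` simultaneously approximate any given unimodular numbers. -/
theorem kronecker_approximation {ι : Type*} [Fintype ι] [DecidableEq ι] (θ : ι → ℝ)
    (hθ : ∀ c : ι → ℤ, ∑ i, (c i : ℝ) * θ i = 0 → c = 0) (z : ι → ℂ) (hz : ∀ i, ‖z i‖ = 1)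
    (ε : ℝ) (hε : 0 < ε) :
    ∃ t : ℝ, ∀ i, ‖Complex.exp (Complex.I * (t * θ i)) - z i‖ < ε := by
  wlog hε1 : ε ≤ 1 generalizing ε
  · obtain ⟨t, ht⟩ := this 1 one_pos le_rfl
    exact ⟨t, fun i => (ht i).trans_le (not_le.mp hε1).le⟩
  by_contra! hcon
  -- An extra term 1 of frequency 0 serves as reference: the sum nears its trivial bound only if
  -- every conj(z i) · exp(i t θ i) is near 1.
  let φ : Option ι → ℝ := fun o => o.elim 0 θ
  let a : Option ι → ℂ := fun o => o.elim 1 fun i => (starRingEnd ℂ) (z i)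
  have hnorm1 : ∀ x : ℝ, ‖Complex.exp (Complex.I * x)‖ = 1 := by
    intro x
    rw [mul_comm]
    exact Complex.norm_exp_ofReal_mul_I x
  -- If some phase is always ε off its target, the parallelogram law bounds that term plus the
  -- reference term by √(4 - ε²) < 2.
  have hcard := card_le_of_forall_norm_trigPoly_le φ ?_ a ?_
    ((Fintype.card ι : ℝ) - 1 + √(4 - ε ^ 2)) ?_
  · rw [Fintype.card_option] at hcard
    have : √(4 - ε ^ 2) < 2 := by
      rw [Real.sqrt_lt' two_pos]
      nlinarith
    push_cast at hcard
    linarith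
  · intro p ν hν ν' hν' h
    simp only [Finset.mem_coe, Finset.mem_piAntidiag, Fintype.sum_option] at hν hν' h
    have h0 := hθ (fun i => (ν (some i) : ℤ) - ν' (some i)) (by
      simp only [φ, Option.elim, mul_zero, zero_add] at h
      push_cast
      simp_rw [sub_mul]
      rw [Finset.sum_sub_distrib, h, sub_self])
    have h1 : ∀ i, ν (some i) = ν' (some i) := by
      intro i
      have := congrFun h0 i
      simp only [Pi.zero_apply] at this
      omega
    have h2 : ν none = ν' none := by
      have e := hν.1.trans hν'.1.symm
      simp only [h1] at e
      omega
    funext o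
    cases o with
    | none => exact h2
    | some i => exact h1 i
  · intro o
    cases o with
    | none => simp [a]
    | some i => simp [a, hz]
  · intro t
    obtain ⟨i, hi⟩ := hcon t
    rw [Fintype.sum_option, ← Finset.add_sum_erase _ _ (Finset.mem_univ i), ← add_assoc]
    refine (norm_add_le _ _).trans ?_
    rw [add_comm]
    have hrest : ‖∑ x ∈ Finset.univ.erase i,
        a (some x) * Complex.exp (Complex.I * (t * φ (some x)))‖ ≤ (Fintype.card ι : ℝ) - 1 := by
      refine (norm_sum_le _ _).trans ?_
      have : ∀ x ∈ Finset.univ.erase i,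
          ‖a (some x) * Complex.exp (Complex.I * (t * φ (some x)))‖ = 1 := by
        intro x _
        rw [norm_mul, ← Complex.ofReal_mul, hnorm1]
        simp [a, hz]
      rw [Finset.sum_congr rfl this, Finset.sum_const, Finset.card_erase_of_mem (Finset.mem_univ i),
        nsmul_eq_mul, mul_one, Finset.card_univ,
        Nat.cast_sub (Fintype.card_pos_iff.mpr ⟨i⟩), Nat.cast_one]
    refine add_le_add hrest (Real.le_sqrt_of_sq_le ?_)
    set w := Complex.exp (Complex.I * (t * θ i)) with hw
    have hwn : ‖w‖ = 1 := by
      rw [hw, ← Complex.ofReal_mul]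
      exact hnorm1 _
    have hzz : (starRingEnd ℂ) (z i) * z i = 1 := by
      rw [mul_comm, Complex.mul_conj, Complex.normSq_eq_norm_sq, hz]
      simp
    have e1 : a none * Complex.exp (Complex.I * (t * φ none)) +
        a (some i) * Complex.exp (Complex.I * (t * φ (some i))) =
        (starRingEnd ℂ) (z i) * (z i + w) := by
      simp only [a, φ, Option.elim, Complex.ofReal_zero, mul_zero, Complex.exp_zero, mul_add, hzz]
      simp [hw]
    rw [e1, norm_mul, RCLike.norm_conj, hz, one_mul]
    have hpar := parallelogram_law_with_norm ℝ w (z i)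
    rw [hwn, hz, add_comm w] at hpar
    nlinarith [norm_nonneg (w - z i)]

/-! ### The transition matrix on eigenvectors. -/

theorem exp_mulVec_of_eigenvector {V : Type*} [Fintype V] [DecidableEq V] (A : Matrix V V ℂ)
    (v : V → ℂ) (μ : ℂ) (h : A.mulVec v = μ • v) :
    (NormedSpace.exp A).mulVec v = Complex.exp μ • v := by
  let : NormedRing (Matrix V V ℂ) := Matrix.linftyOpNormedRing
  let : NormedAlgebra ℂ (Matrix V V ℂ) := Matrix.linftyOpNormedAlgebra
  have hpow : ∀ k : ℕ, (A ^ k).mulVec v = μ ^ k • v := by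
    intro k
    induction k with
    | zero => simp
    | succ k ih =>
      rw [pow_succ, ← Matrix.mulVec_mulVec, h, Matrix.mulVec_smul, ih, smul_smul, pow_succ, mul_comm]
  have hs := NormedSpace.exp_series_hasSum_exp' (𝕂 := ℂ) A
  have hcont : Continuous fun B : Matrix V V ℂ => B.mulVec v :=
    continuous_id.matrix_mulVec continuous_const
  have hs' := hs.map (Matrix.mulVecBilin ℂ ℂ |>.flip v) hcont
  have hμ := (NormedSpace.exp_series_hasSum_exp' (𝕂 := ℂ) μ).smul_const v
  rw [← Complex.exp_eq_exp_ℂ] at hμ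
  refine hs'.unique ?_
  convert hμ using 2 with k
  simp [hpow, smul_smul]

theorem transition_mulVec_of_eigenvector {V : Type*} [Fintype V] [DecidableEq V]
    (M : Matrix V V ℝ) (v : V → ℝ) (μ : ℝ) (h : M.mulVec v = μ • v) (t : ℝ) :
    (transition M t).mulVec (fun j => (v j : ℂ)) =
      Complex.exp (Complex.I * (t * μ)) • fun j => (v j : ℂ) := by
  refine exp_mulVec_of_eigenvector _ _ _ ?_
  ext j
  have := congrArg (fun x : ℝ => (x : ℂ)) (congrFun h j)
  simp only [Matrix.mulVec, dotProduct, Pi.smul_apply, smul_eq_mul] at this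
  push_cast at this
  rw [Matrix.smul_mulVec, Pi.smul_apply, Pi.smul_apply, smul_eq_mul, smul_eq_mul]
  simp only [Matrix.mulVec, dotProduct, Matrix.map_apply]
  rw [this]
  ring

theorem transition_transpose {V : Type*} [Fintype V] [DecidableEq V] (M : Matrix V V ℝ)
    (hM : M.IsSymm) (t : ℝ) : (transition M t).transpose = transition M t := by
  rw [transition, ← Matrix.exp_transpose, Matrix.transpose_smul, ← Matrix.transpose_map, hM]

theorem dotProduct_transition_mulVec {V : Type*} [Fintype V] [DecidableEq V]
    (M : Matrix V V ℝ) (hM : M.IsSymm) (v : V → ℝ) (μ : ℝ) (h : M.mulVec v = μ • v) (t : ℝ)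
    (x : V → ℂ) :
    (fun j => (v j : ℂ)) ⬝ᵥ (transition M t).mulVec x =
      Complex.exp (Complex.I * (t * μ)) * ((fun j => (v j : ℂ)) ⬝ᵥ x) := by
  rw [Matrix.dotProduct_mulVec, ← Matrix.mulVec_transpose, transition_transpose M hM,
    transition_mulVec_of_eigenvector M v μ h, smul_dotProduct, smul_eq_mul]

/-! ### Spectrum of the path with end potentials. -/

/-- The `r`-th eigenvector of the path with end potentials. -/
noncomputable def pathEigenvector (n r : ℕ) (j : Fin n) : ℝ :=
  Real.cos (Real.pi * r * (2 * (j : ℕ) + 1) / (2 * n))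

/-- The `r`-th eigenvalue of the path with end potentials. -/
noncomputable def pathEigenvalue (n r : ℕ) : ℝ := 2 * Real.cos (Real.pi * r / n)

theorem endPotentialPath_isSymm (n : ℕ) : (endPotentialPath n).IsSymm := by
  classical
  rw [endPotentialPath, hamiltonian]
  exact (SimpleGraph.isSymm_adjMatrix _).add (Matrix.isSymm_diagonal _)

theorem endPotentialPath_apply (n : ℕ) (j k : Fin n) :
    endPotentialPath n j k = (if (j : ℕ) + 1 = k then 1 else 0) + (if (k : ℕ) + 1 = j then 1 else 0)
      + if j = k then endPotential n j else 0 := by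
  rw [endPotentialPath, hamiltonian, Matrix.add_apply, Matrix.diagonal_apply,
    SimpleGraph.adjMatrix_apply, SimpleGraph.pathGraph_adj]
  congr 1
  split_ifs <;> first | omega | simp

theorem endPotentialPath_mulVec_apply (n : ℕ) (f : ℕ → ℝ) (j : Fin n) :
    (endPotentialPath n).mulVec (fun k => f k) j =
      (if (j : ℕ) + 1 < n then f (j + 1) else 0) + (if 0 < (j : ℕ) then f (j - 1) else 0)
        + endPotential n j * f j := by
  simp only [Matrix.mulVec, dotProduct, endPotentialPath_apply, add_mul, ite_mul, one_mul, zero_mul,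
    Finset.sum_add_distrib, Finset.sum_ite_eq, Finset.mem_univ, if_true]
  congr 2
  · rw [Fin.sum_univ_eq_sum_range (fun k => if (j : ℕ) + 1 = k then f k else 0)]
    simp
  · rw [Fin.sum_univ_eq_sum_range (fun k => if k + 1 = (j : ℕ) then f k else 0)]
    split_ifs with h
    · obtain ⟨m, hm⟩ : ∃ m, (j : ℕ) = m + 1 := ⟨j - 1, by omega⟩
      have : m < n := by omega
      simp [hm, this]
    · refine Finset.sum_eq_zero fun k _ => if_neg (by omega)

/-- The cosine, extended beyond the path, is symmetric about -1/2 and n - 1/2. The missing neighbour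
of an end vertex thus carries the same value as that vertex, which is the contribution of potential
1. No bound on r is needed, so indices beyond n may be used later. -/
theorem endPotentialPath_mulVec_pathEigenvector {n : ℕ} (hn : 2 ≤ n) (r : ℕ) :
    (endPotentialPath n).mulVec (pathEigenvector n r) =
      pathEigenvalue n r • pathEigenvector n r := by
  have hn0 : (n : ℝ) ≠ 0 := by positivity
  let f : ℝ → ℝ := fun x => Real.cos (Real.pi * r * (2 * x + 1) / (2 * n))
  have hrec : ∀ x, f (x + 1) + f (x - 1) = pathEigenvalue n r * f x := by
    intro x
    have e1 : Real.pi * r * (2 * (x + 1) + 1) / (2 * n) =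
        Real.pi * r * (2 * x + 1) / (2 * n) + Real.pi * r / n := by field_simp; ring
    have e2 : Real.pi * r * (2 * (x - 1) + 1) / (2 * n) =
        Real.pi * r * (2 * x + 1) / (2 * n) - Real.pi * r / n := by field_simp; ring
    simp only [f, pathEigenvalue, e1, e2, Real.cos_add, Real.cos_sub]
    ring
  have hleft : f (0 - 1) = f 0 := by
    simp only [f]
    rw [← Real.cos_neg]
    congr 1
    ring
  have hright : f n = f (n - 1) := by
    simp only [f]
    rw [← Real.cos_neg, ← Real.cos_add_nat_mul_two_pi _ r]
    congr 1
    field_simp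
    ring
  ext j
  have hv : pathEigenvector n r = fun k : Fin n => f (k : ℕ) := rfl
  rw [hv, endPotentialPath_mulVec_apply n (fun m : ℕ => f m), Pi.smul_apply, smul_eq_mul, ← hrec, endPotential]
  have hj := j.2
  by_cases h0 : (j : ℕ) = 0
  · have h1 : (j : ℕ) + 1 < n := by omega
    simp only [h0] at h1 ⊢
    rw [Nat.cast_zero, hleft]
    simp [h1]
  · have hpos : 0 < (j : ℕ) := by omega
    by_cases h1 : (j : ℕ) + 1 < n
    · rw [if_pos h1, if_pos hpos, if_neg (by omega), Nat.cast_sub hpos]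
      push_cast
      ring
    · have h2 : (j : ℕ) + 1 = n := by omega
      have h3 : (j : ℝ) = n - 1 := by rw [eq_sub_iff_add_eq]; exact_mod_cast h2
      rw [if_neg h1, if_pos hpos, if_pos (Or.inr h2), Nat.cast_sub hpos, h3]
      have h4 : f ((n : ℝ) - 1 + 1) = f (n - 1) := by rw [← hright]; ring_nf
      rw [h4]
      push_cast
      ring

/-- Reflecting the path multiplies the `r`-th eigenvector by `(-1) ^ r`. -/
theorem pathEigenvector_rev {n : ℕ} (r : ℕ) (j : Fin n) :
    pathEigenvector n r j.rev = (-1) ^ r * pathEigenvector n r j := by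
  have hn0 : (n : ℝ) ≠ 0 := by
    have := j.2
    exact_mod_cast (by omega : n ≠ 0)
  have h : (((j.rev : Fin n) : ℕ) : ℝ) = n - (j + 1) := by
    rw [Fin.val_rev, Nat.cast_sub j.2]
    push_cast
    ring
  rw [pathEigenvector, pathEigenvector, h, ← Real.cos_nat_mul_pi_sub]
  congr 1
  field_simp
  ring

theorem pathEigenvalue_injOn (n : ℕ) : Set.InjOn (pathEigenvalue n) (Set.Iio n) := by
  intro r hr s hs h
  have hr : r < n := hr
  have hs : s < n := hs
  have hn : (0 : ℝ) < n := by exact_mod_cast (by omega : 0 < n)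
  have mem : ∀ r : ℕ, r < n → Real.pi * r / n ∈ Set.Icc 0 Real.pi := by
    intro r hr
    have : (r : ℝ) ≤ n := by exact_mod_cast hr.le
    refine ⟨by positivity, ?_⟩
    rw [div_le_iff₀ hn]
    exact mul_le_mul_of_nonneg_left this Real.pi_pos.le
  have h2 := Real.injOn_cos (mem r hr) (mem s hs) (by
    unfold pathEigenvalue at h
    linarith)
  field_simp at h2
  exact_mod_cast h2

theorem pathEigenvector_zero_pos {n r : ℕ} (hr : r < n) :
    0 < pathEigenvector n r ⟨0, by omega⟩ := by
  have hn : (0 : ℝ) < n := by exact_mod_cast (by omega : 0 < n)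
  have hr' : (r : ℝ) < n := by exact_mod_cast hr
  rw [pathEigenvector]
  refine Real.cos_pos_of_mem_Ioo ⟨?_, ?_⟩
  · have : 0 ≤ Real.pi * r * (2 * ((0 : ℕ) : ℝ) + 1) / (2 * n) := by positivity
    linarith [Real.pi_pos]
  · push_cast
    rw [div_lt_div_iff₀ (by positivity) two_pos]
    nlinarith [Real.pi_pos]

theorem span_pathEigenvector {n : ℕ} (hn : 2 ≤ n) (x : Fin n → ℝ) :
    ∃ c : Fin n → ℝ, ∀ j, x j = ∑ r : Fin n, c r * pathEigenvector n r j := by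
  have : Nonempty (Fin n) := ⟨⟨0, by omega⟩⟩
  have hli : LinearIndependent ℝ (fun r : Fin n => pathEigenvector n r) := by
    refine Module.End.eigenvectors_linearIndependent' (Matrix.toLin' (endPotentialPath n))
      (fun r : Fin n => pathEigenvalue n r) ?_ _ ?_
    · intro r s h
      exact Fin.ext (pathEigenvalue_injOn n r.2 s.2 h)
    · intro r
      rw [Module.End.hasEigenvector_iff, Module.End.mem_eigenspace_iff]
      refine ⟨?_, ?_⟩
      · rw [Matrix.toLin'_apply, endPotentialPath_mulVec_pathEigenvector hn]
      · intro h
        exact (pathEigenvector_zero_pos r.2).ne' (congrFun h ⟨0, by omega⟩)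
  let b := basisOfLinearIndependentOfCardEqFinrank hli (by simp)
  refine ⟨fun r => b.repr x r, fun j => ?_⟩
  have := congrFun (b.sum_repr x) j
  rw [← this, Finset.sum_apply]
  simp [b]

/-! ### Necessity: transfer forces a power of two. -/

theorem dotProduct_vertexState {V : Type*} [Fintype V] [DecidableEq V] (v : V → ℝ) (a : V) :
    (fun j => (v j : ℂ)) ⬝ᵥ (fun j => (vertexState a j : ℂ)) = v a := by
  simp [dotProduct, vertexState, Pi.single_apply, apply_ite (fun x : ℝ => (x : ℂ))]

/-- Pretty good vertex state transfer forces the phases of every eigenvector. -/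
theorem tendsto_phase_mul {V : Type*} [Fintype V] [DecidableEq V] {M : Matrix V V ℝ}
    (hM : M.IsSymm) {a b : V} {t : ℕ → ℝ} {γ : ℂ}
    (h : Tendsto (fun k => (transition M (t k)).mulVec (fun j => (vertexState a j : ℂ))) atTop
        (𝓝 (γ • fun j => (vertexState b j : ℂ))))
    {v : V → ℝ} {μ : ℝ} (hv : M.mulVec v = μ • v) :
    Tendsto (fun k => Complex.exp (Complex.I * (t k * μ)) * (v a : ℂ)) atTop
      (𝓝 (γ * v b)) := by
  have hc : Continuous fun x : V → ℂ => (fun j => (v j : ℂ)) ⬝ᵥ x :=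
    Continuous.dotProduct continuous_const continuous_id
  have := (hc.tendsto _).comp h
  simpa [Function.comp_def, dotProduct_transition_mulVec M hM v μ hv, dotProduct_smul,
    dotProduct_vertexState] using this

theorem norm_exp_I_mul_ofReal_mul (t μ : ℝ) : ‖Complex.exp (Complex.I * (t * μ))‖ = 1 := by
  rw [← Complex.ofReal_mul, mul_comm]
  exact Complex.norm_exp_ofReal_mul_I _

/-- Squaring doubles the angle, leaving cos(π(2a+1)/n) = cos(π(2b+1)/n); the size of a and b leaves
only the period k = 0 or the reflection k = 1. -/
theorem eq_or_eq_rev_of_abs_pathEigenvector_one_eq {n : ℕ} {a b : Fin n}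
    (h : |pathEigenvector n 1 a| = |pathEigenvector n 1 b|) : b = a ∨ b = a.rev := by
  have hn : (0 : ℝ) < n := by
    have := a.2
    exact_mod_cast (by omega : 0 < n)
  have h2 := (sq_eq_sq_iff_abs_eq_abs _ _).mpr h
  simp only [pathEigenvector, Real.cos_sq] at h2
  have h3 : Real.cos (2 * (Real.pi * (1 : ℕ) * (2 * (a : ℕ) + 1) / (2 * n))) =
      Real.cos (2 * (Real.pi * (1 : ℕ) * (2 * (b : ℕ) + 1) / (2 * n))) := by linarith
  have ha := a.2
  have hb := b.2
  rw [Real.cos_eq_cos_iff] at h3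
  obtain ⟨k, hk | hk⟩ := h3
  · left
    field_simp at hk
    have hk' : (2 * (b : ℕ) + 1 : ℤ) = 2 * k * n + (2 * (a : ℕ) + 1) := by
      have : (2 * (b : ℕ) + 1 : ℝ) = 2 * k * n + (2 * (a : ℕ) + 1) := by
        push_cast at hk
        linarith
      exact_mod_cast this
    have hk0 : k = 0 := by
      have h1 : k < 1 := by
        by_contra! h
        nlinarith
      have h2 : -1 < k := by
        by_contra! h
        nlinarith
      omega
    subst hk0
    apply Fin.ext
    omega
  · right
    field_simp at hk
    have hk' : (2 * (b : ℕ) + 1 : ℤ) = 2 * k * n - (2 * (a : ℕ) + 1) := by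
      have : (2 * (b : ℕ) + 1 : ℝ) = 2 * k * n - (2 * (a : ℕ) + 1) := by
        push_cast at hk
        linarith
      exact_mod_cast this
    have hk0 : k = 1 := by
      have h1 : k < 2 := by
        by_contra! h
        nlinarith
      have h2 : 0 < k := by
        by_contra! h
        nlinarith
      omega
    subst hk0
    apply Fin.ext
    rw [Fin.val_rev]
    omega

/-- Turns vanishing of an eigenvector entry into an integer equation that parity can refute. -/
theorem pathEigenvector_eq_zero {n r : ℕ} {j : Fin n} (h : pathEigenvector n r j = 0) :
    ∃ k : ℤ, (r : ℤ) * (2 * (j : ℕ) + 1) = n * (2 * k + 1) := by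
  have hn : (n : ℝ) ≠ 0 := by
    have := j.2
    exact_mod_cast (by omega : n ≠ 0)
  obtain ⟨k, hk⟩ := Real.cos_eq_zero_iff.mp h
  refine ⟨k, ?_⟩
  field_simp at hk
  have : (r : ℝ) * (2 * (j : ℕ) + 1) = n * (2 * k + 1) := by linarith
  exact_mod_cast this

/-- Raising the index by 2q rotates the angle by 2π/p, so this is twice the real part of a rotated
sum of all p-th roots of unity. The even step keeps the sign (-1)^r constant along the class. -/
theorem sum_pathEigenvalue_eq_zero {p q : ℕ} (hp : 1 < p) (hq : 0 < q) (r : ℕ) :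
    ∑ j ∈ Finset.range p, pathEigenvalue (p * q) (r + 2 * q * j) = 0 := by
  have hp0 : (p : ℂ) ≠ 0 := by exact_mod_cast (by omega : p ≠ 0)
  have hq0 : (q : ℂ) ≠ 0 := by exact_mod_cast hq.ne'
  have hprim := (Complex.isPrimitiveRoot_exp p (by omega)).geom_sum_eq_zero hp
  have h2 : ∑ j ∈ Finset.range p,
      Complex.exp ((Real.pi * (r + 2 * q * j : ℕ) / (p * q : ℕ) : ℝ) * Complex.I) = 0 := by
    have : ∀ j ∈ Finset.range p,
        Complex.exp ((Real.pi * (r + 2 * q * j : ℕ) / (p * q : ℕ) : ℝ) * Complex.I) =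
        Complex.exp (Real.pi * r / (p * q) * Complex.I) *
          Complex.exp (2 * Real.pi * Complex.I / p) ^ j := by
      intro j _
      rw [← Complex.exp_nat_mul, ← Complex.exp_add]
      congr 1
      push_cast
      field_simp
    rw [Finset.sum_congr rfl this, ← Finset.mul_sum, hprim, mul_zero]
  have h3 := congrArg Complex.re h2
  rw [Complex.re_sum] at h3
  simp only [Complex.exp_ofReal_mul_I_re, Complex.zero_re] at h3
  simp only [pathEigenvalue]
  rw [← Finset.mul_sum, h3, mul_zero]

/-- Limits of phases with frequencies summing to zero have product one. -/
theorem prod_phase_limits_eq_one {ι : Type*} (S : Finset ι) (μ : ι → ℝ) (hμ : ∑ i ∈ S, μ i = 0)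
    (t : ℕ → ℝ) (z : ι → ℂ)
    (h : ∀ i ∈ S, Tendsto (fun k => Complex.exp (Complex.I * (t k * μ i))) atTop (𝓝 (z i))) :
    ∏ i ∈ S, z i = 1 := by
  have hp := tendsto_finsetProd S h
  refine tendsto_nhds_unique hp ?_
  have : ∀ k, ∏ i ∈ S, Complex.exp (Complex.I * (t k * μ i)) = 1 := by
    intro k
    rw [← Complex.exp_sum, ← Finset.mul_sum, ← Finset.mul_sum, ← Complex.ofReal_sum, hμ]
    simp
  simp [this]

theorem eq_two_pow_of_admitsVertexPGST {n : ℕ} (h : AdmitsVertexPGST (endPotentialPath n)) :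
    ∃ k : ℕ, 1 ≤ k ∧ n = 2 ^ k := by
  obtain ⟨a, b, -, -, hli, t, γ, hγ, hlim⟩ := h
  have hab : a ≠ b := by
    rintro rfl
    have := hli.injective (a₁ := 0) (a₂ := 1) (by simp)
    exact absurd this (by simp)
  have hn : 2 ≤ n := by
    have := a.2
    have := b.2
    by_contra! hlt
    exact hab (Fin.ext (by omega))
  have hphase := fun r => tendsto_phase_mul (endPotentialPath_isSymm n) hlim
    (endPotentialPath_mulVec_pathEigenvector hn r)
  have hb : b = a.rev := by
    refine (eq_or_eq_rev_of_abs_pathEigenvector_one_eq ?_).resolve_left hab.symm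
    have h1 := (hphase 1).norm
    simp only [norm_mul, norm_exp_I_mul_ofReal_mul, hγ, one_mul, Complex.norm_real,
      Real.norm_eq_abs] at h1
    exact tendsto_nhds_unique tendsto_const_nhds h1
  have hsupp : ∀ r, pathEigenvector n r a ≠ 0 →
      Tendsto (fun k => Complex.exp (Complex.I * (t k * pathEigenvalue n r))) atTop
        (𝓝 (γ * (-1) ^ r)) := by
    intro r hr
    have hr' : (pathEigenvector n r a : ℂ) ≠ 0 := by exact_mod_cast hr
    have h1 := (hphase r).div_const (pathEigenvector n r a : ℂ)
    rw [hb, pathEigenvector_rev] at h1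
    push_cast at h1
    rw [← mul_assoc, mul_div_cancel_right₀ _ hr'] at h1
    simpa [mul_div_cancel_right₀ _ hr'] using h1
  rcases Nat.eq_two_pow_or_exists_odd_prime_and_dvd n with ⟨k, hk⟩ | ⟨p, hp, ⟨q, hq⟩, hodd⟩
  · refine ⟨k, ?_, hk⟩
    by_contra! hk0
    obtain rfl : k = 0 := by omega
    omega
  exfalso
  have hq0 : 0 < q := by
    rcases Nat.eq_zero_or_pos q with h0 | h0
    · simp [h0] at hq; omega
    · exact h0
  have hclass : ∀ r, (∀ j, pathEigenvector n (r + 2 * q * j) a ≠ 0) → (γ * (-1) ^ r) ^ p = 1 := by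
    intro r hr
    have h1 := prod_phase_limits_eq_one (Finset.range p)
      (fun j => pathEigenvalue n (r + 2 * q * j)) (by
        rw [hq]; exact sum_pathEigenvalue_eq_zero hp.one_lt hq0 r) t _
      (fun j _ => hsupp _ (hr j))
    have h2 : ∀ j : ℕ, (-1 : ℂ) ^ (r + 2 * q * j) = (-1) ^ r := by
      intro j
      rw [pow_add, mul_assoc, pow_mul, neg_one_sq, one_pow, mul_one]
    simpa [h2] using h1
  have hmid : ∀ m, n = 2 * m → γ * (-1) ^ m = 1 := by
    intro m hm
    have hne : pathEigenvector n m a ≠ 0 := by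
      intro h0
      obtain ⟨k, hk⟩ := pathEigenvector_eq_zero h0
      have hm0 : (m : ℤ) ≠ 0 := by omega
      have : (m : ℤ) * (2 * (a : ℕ) + 1) = m * (2 * (2 * k + 1)) := by
        rw [hk, hm]; push_cast; ring
      have := mul_left_cancel₀ hm0 this
      omega
    have hθ : pathEigenvalue n m = 0 := by
      have hm0 : (m : ℝ) ≠ 0 := by exact_mod_cast (by omega : m ≠ 0)
      have : Real.pi * m / n = Real.pi / 2 := by
        rw [hm]; push_cast; field_simp
      rw [pathEigenvalue, this, Real.cos_pi_div_two, mul_zero]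
    simpa using prod_phase_limits_eq_one {m} (pathEigenvalue n) (by simpa using hθ) t
      (fun r => γ * (-1) ^ r) (by simpa using hsupp m hne)
  rcases Nat.even_or_odd' n with ⟨m, hm | hm⟩
  · have h1 := hmid m hm
    rcases Nat.even_or_odd' m with ⟨l, hl | hl⟩
    · have hγ1 : γ = 1 := by simpa [hl, pow_mul] using h1
      have h2 := hclass 1 (by
        intro j h0
        obtain ⟨k, hk⟩ := pathEigenvector_eq_zero h0
        have := congrArg (fun x : ℤ => x % 2) hk
        simp [hm, Int.mul_emod, Int.add_emod] at this)
      rw [hγ1, one_mul, pow_one, hodd.neg_one_pow] at h2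
      norm_num at h2
    · have hγ1 : γ = -1 := by
        rw [hl, pow_succ, pow_mul, neg_one_sq, one_pow, one_mul] at h1
        linear_combination -h1
      obtain ⟨s, hs⟩ : Even q := by
        have : Even (p * q) := by rw [← hq, hm]; exact even_two_mul m
        exact (Nat.even_mul.mp this).resolve_left (Nat.not_even_iff_odd.mpr hodd)
      have h2 := hclass 0 (by
        intro j h0
        obtain ⟨k, hk⟩ := pathEigenvector_eq_zero h0
        -- Modulo 4: the left side is divisible by 4 since q is even, while n(2k+1) is twice an odd
        -- number.
        have e : (2 : ℤ) * (2 * (s * j * (2 * (a : ℕ) + 1))) = 2 * (2 * (2 * l * k + l + k) + 1) := by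
          have hn' : (n : ℤ) = 2 * (2 * l + 1) := by omega
          rw [hn', hs] at hk
          push_cast at hk
          linear_combination hk
        generalize (s * j * (2 * (a : ℕ) + 1) : ℤ) = X at e
        generalize (2 * l * k + l + k : ℤ) = Y at e
        omega)
      rw [hγ1, pow_zero, mul_one, hodd.neg_one_pow] at h2
      norm_num at h2
  · have heven : ∀ s, pathEigenvector n (2 * s) a ≠ 0 := by
      intro s h0
      obtain ⟨k, hk⟩ := pathEigenvector_eq_zero h0
      have := congrArg (fun x : ℤ => x % 2) hk
      simp [hm, Int.mul_emod, Int.add_emod] at this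
    have h2 := hclass 0 (by
      intro j
      rw [zero_add, mul_assoc]
      exact heven _)
    rw [pow_zero, mul_one] at h2
    -- Vanishing would give 2a+1 = n(a-k) with 0 < 2a+1 < 2n, hence n = 2a+1. Then a would be the
    -- central vertex, equal to its mirror image b.
    have hne : pathEigenvector n (n - 2) a ≠ 0 := by
      intro h0
      obtain ⟨k, hk⟩ := pathEigenvector_eq_zero h0
      rw [Nat.cast_sub hn] at hk
      have e : (2 * (a : ℕ) + 1 : ℤ) = n * ((a : ℕ) - k) := by
        push_cast at hk
        linarith
      have ha := a.2
      have h1 : ((a : ℕ) - k : ℤ) = 1 := by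
        have h1 : ((a : ℕ) - k : ℤ) < 2 := by
          by_contra! h
          nlinarith
        have h2 : 0 < ((a : ℕ) - k : ℤ) := by
          by_contra! h
          nlinarith
        omega
      rw [h1, mul_one] at e
      apply hab
      rw [hb]
      apply Fin.ext
      rw [Fin.val_rev]
      omega
    have hsum : pathEigenvalue n 2 + pathEigenvalue n (n - 2) = 0 := by
      have hn0 : (n : ℝ) ≠ 0 := by exact_mod_cast (by omega : n ≠ 0)
      have e : Real.pi * ((n - 2 : ℕ) : ℝ) / n = Real.pi - Real.pi * (2 : ℕ) / n := by
        rw [Nat.cast_sub hn]; push_cast; field_simp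
      rw [pathEigenvalue, pathEigenvalue, e, Real.cos_pi_sub]
      ring
    have h3 := prod_phase_limits_eq_one Finset.univ ![pathEigenvalue n 2, pathEigenvalue n (n - 2)]
      (by simpa using hsum) t ![γ * (-1) ^ 2, γ * (-1) ^ (n - 2)] (by
        intro i _
        fin_cases i
        · exact hsupp 2 (heven 1)
        · exact hsupp (n - 2) hne)
    have hodd2 : Odd (n - 2) := by
      rw [Nat.odd_iff]; omega
    simp only [Fin.prod_univ_two, Matrix.cons_val_zero, Matrix.cons_val_one, hodd2.neg_one_pow,
      neg_one_sq] at h3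
    -- The indices 2 and n-2 have opposite parity, so the limits γ and -γ multiply to 1; this is
    -- incompatible with γ^p = 1 for p odd.
    have h4 : γ ^ 2 = -1 := by linear_combination -h3
    have h5 : (γ ^ 2) ^ p = 1 := by rw [← pow_mul, mul_comm, pow_mul, h2, one_pow]
    rw [h4, hodd.neg_one_pow] at h5
    norm_num at h5

/-! ### Sufficiency: independence of the eigenvalues and transfer between the ends. -/

/-- Integer combinations of the powers `ζ ^ i`, `i < 2 ^ k`, of a primitive `2 ^ (k + 1)`-th root
of unity vanish only trivially. -/
theorem eq_zero_of_sum_int_mul_pow_eq_zero {k : ℕ} {ζ : ℂ} (hζ : IsPrimitiveRoot ζ (2 ^ (k + 1)))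
    (d : ℕ → ℤ) (h : ∑ i ∈ Finset.range (2 ^ k), (d i : ℂ) * ζ ^ i = 0) :
    ∀ i < 2 ^ k, d i = 0 := by
  have hint : IsIntegral ℤ ζ := hζ.isIntegral (by positivity)
  have hdeg : (minpoly ℚ ζ).natDegree = 2 ^ k := by
    rw [← Polynomial.cyclotomic_eq_minpoly_rat hζ (by positivity), Polynomial.natDegree_cyclotomic,
      Nat.totient_prime_pow_succ Nat.prime_two]
    simp
  have hli := linearIndependent_pow (K := ℚ) ζ
  rw [hdeg] at hli
  have h2 := Fintype.linearIndependent_iff.mp hli (fun i => (d i : ℚ)) (by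
    rw [Fin.sum_univ_eq_sum_range (fun i => ((d i : ℚ)) • ζ ^ i), ← h]
    refine Finset.sum_congr rfl fun i _ => ?_
    rw [Algebra.smul_def]
    simp)
  intro i hi
  exact_mod_cast h2 ⟨i, hi⟩

/-- The first half of the eigenvalues is linearly independent when the length is a power of two. -/
theorem eq_zero_of_sum_mul_pathEigenvalue_eq_zero (k : ℕ) (c : Fin (2 ^ k) → ℤ)
    (h : ∑ i, (c i : ℝ) * pathEigenvalue (2 ^ (k + 1)) i = 0) : c = 0 := by
  set ζ : ℂ := Complex.exp (2 * Real.pi * Complex.I / (2 ^ (k + 1 + 1) : ℕ)) with hζdef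
  have hζ : IsPrimitiveRoot ζ (2 ^ (k + 1 + 1)) :=
    Complex.isPrimitiveRoot_exp _ (by positivity)
  have hζ0 : ζ ≠ 0 := Complex.exp_ne_zero _
  have hζhalf : ζ ^ (2 ^ (k + 1)) = -1 := by
    rw [hζdef, ← Complex.exp_nat_mul, ← Complex.exp_pi_mul_I]
    congr 1
    push_cast
    rw [pow_succ _ (k + 1)]
    field_simp
  -- Since ζ^(2^(k+1)) = -1, the inverse ζ^(-i) in 2cos = ζ^i + ζ^(-i) becomes -ζ^(2^(k+1)-i), an
  -- exponent in the range of the power basis except when i = 0.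
  have hval : ∀ i ≤ 2 ^ (k + 1), ((pathEigenvalue (2 ^ (k + 1)) i : ℝ) : ℂ) =
      ζ ^ i - ζ ^ (2 ^ (k + 1) - i) := by
    intro i hi
    have e1 : ζ ^ (2 ^ (k + 1) - i) = -(ζ ^ i)⁻¹ := by
      rw [pow_sub₀ _ hζ0 hi, hζhalf, neg_one_mul]
    have e2 : ζ ^ i = Complex.exp ((Real.pi * i / (2 ^ (k + 1) : ℕ) : ℝ) * Complex.I) := by
      rw [hζdef, ← Complex.exp_nat_mul]
      congr 1
      push_cast
      rw [pow_succ _ (k + 1)]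
      field_simp
    rw [e1, e2, sub_neg_eq_add, ← Complex.exp_neg, ← neg_mul, pathEigenvalue]
    push_cast
    rw [Complex.two_cos]
  let e : ℕ → ℤ := fun i => if h : i < 2 ^ k then c ⟨i, h⟩ else 0
  have he : ∀ i : Fin (2 ^ k), e i = c i := fun i => by simp [e]
  -- Coefficients in the power basis. At i = 0 the term ζ^(2^(k+1)) = -1 folds back and doubles e 0.
  -- For 0 < i < 2^k the reflected index lies outside the support of e, so d i = e i.
  let d : ℕ → ℤ := fun i => if i = 0 then 2 * e 0 else e i - e (2 ^ (k + 1) - i)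
  have hpos : 0 < 2 ^ k := by positivity
  have hsucc : 2 ^ (k + 1) = 2 * 2 ^ k := by rw [pow_succ, mul_comm]
  have hsum : ∑ i ∈ Finset.range (2 ^ (k + 1)), (d i : ℂ) * ζ ^ i = 0 := by
    have h0 : ∑ i ∈ Finset.range (2 ^ (k + 1)), (e i : ℂ) * (ζ ^ i - ζ ^ (2 ^ (k + 1) - i)) = 0 := by
      have h1 := congrArg (fun x : ℝ => (x : ℂ)) h
      push_cast at h1
      simp_rw [← he] at h1
      rw [Fin.sum_univ_eq_sum_range
        (fun i => (e i : ℂ) * (pathEigenvalue (2 ^ (k + 1)) i : ℂ))] at h1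
      rw [← h1]
      symm
      rw [Finset.sum_subset (Finset.range_mono (by omega : 2 ^ k ≤ 2 ^ (k + 1)))]
      · refine Finset.sum_congr rfl fun i hi => ?_
        rw [hval i (Finset.mem_range.mp hi).le]
      · intro i _ hi
        simp [e, (by simpa using hi : ¬ i < 2 ^ k)]
    obtain ⟨m, hm⟩ : ∃ m, 2 ^ (k + 1) = m + 1 := ⟨2 ^ (k + 1) - 1, by omega⟩
    rw [hm] at hζhalf h0 ⊢
    simp only [mul_sub, Finset.sum_sub_distrib] at h0
    rw [Finset.sum_range_succ', Finset.sum_range_succ' (fun i => (e i : ℂ) * ζ ^ (m + 1 - i)),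
      ← Finset.sum_range_reflect (fun i => (e (i + 1) : ℂ) * ζ ^ (m + 1 - (i + 1)))] at h0
    rw [Finset.sum_range_succ']
    simp only [d, hm, if_true, Nat.succ_ne_zero, if_false, Int.cast_sub, sub_mul,
      Finset.sum_sub_distrib]
    have h2 : ∑ j ∈ Finset.range m, (e (m - 1 - j + 1) : ℂ) * ζ ^ (m + 1 - (m - 1 - j + 1)) =
        ∑ j ∈ Finset.range m, (e (m + 1 - (j + 1)) : ℂ) * ζ ^ (j + 1) := by
      refine Finset.sum_congr rfl fun j hj => ?_
      have := Finset.mem_range.mp hj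
      rw [show m - 1 - j + 1 = m + 1 - (j + 1) by omega,
        show m + 1 - (m + 1 - (j + 1)) = j + 1 by omega]
    rw [h2, Nat.sub_zero, hζhalf] at h0
    simp only [Nat.add_sub_add_right] at h0 ⊢
    push_cast
    linear_combination h0
  have hd := eq_zero_of_sum_int_mul_pow_eq_zero hζ d hsum
  funext i
  have h1 := hd i (by omega)
  rw [← he]
  simp only [d] at h1
  by_cases hi : (i : ℕ) = 0
  · rw [if_pos hi] at h1
    rw [hi, Pi.zero_apply]
    omega
  · rw [if_neg hi] at h1
    have hlt := i.2
    have : e (2 ^ (k + 1) - i) = 0 := by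
      simp only [e]
      exact dif_neg (by omega)
    rw [this, sub_zero] at h1
    exact h1

theorem vertexState_isRealPureState {V : Type*} [Fintype V] [DecidableEq V] (a : V) :
    IsRealPureState (vertexState a) := by
  simp [IsRealPureState, vertexState]

theorem linearIndependent_vertexState {V : Type*} [Fintype V] [DecidableEq V] {a b : V}
    (hab : a ≠ b) : LinearIndependent ℝ ![vertexState a, vertexState b] := by
  rw [LinearIndependent.pair_iff]
  intro s t h
  have ha := congrFun h a
  have hb := congrFun h b
  simp [vertexState, hab, hab.symm] at ha hb
  exact ⟨ha, hb⟩

/-- Times at which all phases are simultaneously almost those of a transfer between the ends. -/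
theorem exists_times_tendsto_phase (k : ℕ) :
    ∃ t : ℕ → ℝ, ∀ r < 2 ^ (k + 1),
      Tendsto (fun m => Complex.exp (Complex.I * (t m * pathEigenvalue (2 ^ (k + 1)) r))) atTop
        (𝓝 ((-1) ^ (2 ^ k) * (-1) ^ r)) := by
  have hkr := fun m : ℕ => kronecker_approximation
    (fun i : Fin (2 ^ k) => pathEigenvalue (2 ^ (k + 1)) i)
    (eq_zero_of_sum_mul_pathEigenvalue_eq_zero k) (fun i => (-1) ^ (2 ^ k) * (-1) ^ (i : ℕ))
    (by simp) (1 / ((m : ℝ) + 1)) (by positivity)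
  choose t ht using hkr
  have hsucc : 2 ^ (k + 1) = 2 * 2 ^ k := by rw [pow_succ, mul_comm]
  have hpos : 0 < 2 ^ k := by positivity
  have hlow : ∀ r < 2 ^ k,
      Tendsto (fun m => Complex.exp (Complex.I * (t m * pathEigenvalue (2 ^ (k + 1)) r))) atTop
        (𝓝 ((-1) ^ (2 ^ k) * (-1) ^ r)) := by
    intro r hr
    rw [tendsto_iff_norm_sub_tendsto_zero]
    exact squeeze_zero (fun _ => norm_nonneg _) (fun m => (ht m ⟨r, hr⟩).le)
      tendsto_one_div_add_atTop_nhds_zero_nat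
  have hreflect : ∀ r ≤ 2 ^ (k + 1),
      pathEigenvalue (2 ^ (k + 1)) r = -pathEigenvalue (2 ^ (k + 1)) (2 ^ (k + 1) - r) := by
    intro r hr
    have e : Real.pi * ((2 ^ (k + 1) - r : ℕ) : ℝ) / (2 ^ (k + 1) : ℕ) =
        Real.pi - Real.pi * r / (2 ^ (k + 1) : ℕ) := by
      rw [Nat.cast_sub hr]
      push_cast
      field_simp
    rw [pathEigenvalue, pathEigenvalue, e, Real.cos_pi_sub]
    ring
  refine ⟨t, fun r hr => ?_⟩
  -- At r = 2^k the eigenvalue is 0 and the phase is 1, which dictates the factor (-1)^(2^k). Above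
  -- it the phase is the conjugate of that at 2^(k+1) - r; the target is real and the two indices
  -- have equal parity.
  rcases lt_trichotomy r (2 ^ k) with hlt | heq | hgt
  · exact hlow r hlt
  · have h0 := hreflect r hr.le
    rw [show 2 ^ (k + 1) - r = r by omega] at h0
    have h1 : pathEigenvalue (2 ^ (k + 1)) r = 0 := by linarith
    rw [h1, heq, ← mul_pow]
    simp
  · have h1 := (Complex.continuous_conj.tendsto _).comp (hlow (2 ^ (k + 1) - r) (by omega))
    have hpar : (-1 : ℂ) ^ (2 ^ (k + 1) - r) = (-1) ^ r := by
      exact neg_one_pow_congr (by rw [Nat.even_sub hr.le]; simp [hsucc])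
    rw [hpar] at h1
    convert h1 using 2 with m
    · rw [Function.comp_apply, ← Complex.exp_conj, hreflect r hr.le]
      simp
    · simp

/-- Expand the end vertex state in the eigenbasis: phases tending to γ(-1)^r act in the limit as γ
times the reflection, which carries one end to the other. -/
theorem admitsVertexPGST_two_pow (k : ℕ) : AdmitsVertexPGST (endPotentialPath (2 ^ (k + 1))) := by
  have hn : 2 ≤ 2 ^ (k + 1) := by
    rw [pow_succ]
    have : 0 < 2 ^ k := by positivity
    omega
  set n := 2 ^ (k + 1) with hndef
  let a : Fin n := ⟨0, by omega⟩
  have hab : a ≠ a.rev := by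
    intro h
    have := congrArg Fin.val h
    simp only [Fin.val_rev, a] at this
    omega
  obtain ⟨t, ht⟩ := exists_times_tendsto_phase k
  rw [← hndef] at ht
  obtain ⟨c, hc⟩ := span_pathEigenvector hn (vertexState a)
  refine ⟨a, a.rev, vertexState_isRealPureState _, vertexState_isRealPureState _,
    linearIndependent_vertexState hab, t, (-1) ^ (2 ^ k), by simp, ?_⟩
  have hexp : ∀ s : ℝ, (transition (endPotentialPath n) s).mulVec
      (fun j => (vertexState a j : ℂ)) = ∑ r : Fin n, (c r : ℂ) •
        (Complex.exp (Complex.I * (s * pathEigenvalue n r)) •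
          fun j => (pathEigenvector n r j : ℂ)) := by
    intro s
    have h1 : (fun j => (vertexState a j : ℂ)) =
        ∑ r : Fin n, (c r : ℂ) • fun j => (pathEigenvector n r j : ℂ) := by
      funext j
      rw [hc j, Finset.sum_apply]
      simp
    rw [h1, Matrix.mulVec_sum]
    refine Finset.sum_congr rfl fun r _ => ?_
    rw [Matrix.mulVec_smul, transition_mulVec_of_eigenvector _ _ _
      (endPotentialPath_mulVec_pathEigenvector hn r)]
  have hrev : ((-1 : ℂ) ^ (2 ^ k) • fun j => (vertexState a.rev j : ℂ)) =
      ∑ r : Fin n, (c r : ℂ) • (((-1) ^ (2 ^ k) * (-1) ^ (r : ℕ) : ℂ) •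
          fun j => (pathEigenvector n r j : ℂ)) := by
    funext j
    have h1 : vertexState a.rev j = vertexState a j.rev := by
      simp only [vertexState, Pi.single_apply, Fin.rev_eq_iff]
    rw [Pi.smul_apply, h1, hc, Finset.sum_apply, smul_eq_mul]
    push_cast
    rw [Finset.mul_sum]
    refine Finset.sum_congr rfl fun r _ => ?_
    rw [pathEigenvector_rev]
    simp only [Pi.smul_apply, smul_eq_mul]
    push_cast
    ring
  simp_rw [hexp]
  rw [hrev]
  exact tendsto_finsetSum _ fun r _ => ((ht r r.2).smul_const _).const_smul _

/-! ### The path as a quotient of the even cycle. -/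

/-- The equitable partition of the cycle `C_{2n}` given by the reflection `v ↦ 2n - 1 - v`. -/
def cycleFold (n : ℕ) (v : Fin (2 * n)) : Fin n :=
  ⟨min v (2 * n - 1 - v), by omega⟩

/-- Both vertices of a cell of `cycleFold` have this many neighbours in another cell. -/
def cycleFoldCount (n : ℕ) (j k : Fin n) : ℕ :=
  (if (j : ℕ) + 1 = k then 1 else 0) + (if (k : ℕ) + 1 = j then 1 else 0) +
    if j = k then (if (j : ℕ) = 0 ∨ (j : ℕ) + 1 = n then 1 else 0) else 0

theorem cycleGraph_two_mul_adj {n : ℕ} (hn : 2 ≤ n) (v w : Fin (2 * n)) :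
    (SimpleGraph.cycleGraph (2 * n)).Adj v w ↔
      (w : ℕ) = (if (v : ℕ) + 1 = 2 * n then 0 else (v : ℕ) + 1) ∨
      (w : ℕ) = (if (v : ℕ) = 0 then 2 * n - 1 else (v : ℕ) - 1) := by
  have hv := v.2
  have hw := w.2
  rw [SimpleGraph.cycleGraph_adj', Fin.val_sub, Fin.val_sub]
  have key : ∀ x y : ℕ, x < 2 * n → y < 2 * n →
      ((2 * n - y + x) % (2 * n) = 1 ↔ x = if y + 1 = 2 * n then 0 else y + 1) := by
    intro x y hx hy
    by_cases hxy : y ≤ x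
    · have e : (2 * n - y + x) % (2 * n) = x - y := by
        rw [show 2 * n - y + x = (x - y) + 2 * n by omega, Nat.add_mod_right,
          Nat.mod_eq_of_lt (by omega)]
      rw [e]
      split_ifs <;> omega
    · rw [Nat.mod_eq_of_lt (by omega)]
      split_ifs <;> omega
  rw [key _ _ hv hw, key _ _ hw hv]
  split_ifs <;> omega

theorem card_filter_cycleFold {n : ℕ} (hn : 2 ≤ n) (v : Fin (2 * n)) (k : Fin n)
    [DecidableRel (SimpleGraph.cycleGraph (2 * n)).Adj] :
    (Finset.univ.filter fun w => (SimpleGraph.cycleGraph (2 * n)).Adj v w ∧ cycleFold n w = k).card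
      = cycleFoldCount n (cycleFold n v) k := by
  have hv := v.2
  have hk := k.2
  let s : Fin (2 * n) := ⟨if (v : ℕ) + 1 = 2 * n then 0 else (v : ℕ) + 1, by split_ifs <;> omega⟩
  let p : Fin (2 * n) := ⟨if (v : ℕ) = 0 then 2 * n - 1 else (v : ℕ) - 1, by split_ifs <;> omega⟩
  have hsp : s ≠ p := by
    intro h
    have := congrArg Fin.val h
    simp only [s, p] at this
    split_ifs at this <;> omega
  have hset : (Finset.univ.filter fun w =>
      (SimpleGraph.cycleGraph (2 * n)).Adj v w ∧ cycleFold n w = k) =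
      ({s, p} : Finset _).filter fun w => cycleFold n w = k := by
    ext w
    simp only [Finset.mem_filter, Finset.mem_univ, true_and, Finset.mem_insert,
      Finset.mem_singleton, cycleGraph_two_mul_adj hn, Fin.ext_iff, s, p]
  rw [hset, Finset.card_filter, Finset.sum_pair hsp]
  have hc : ((cycleFold n v : Fin n) : ℕ) = min (v : ℕ) (2 * n - 1 - v) := rfl
  generalize cycleFold n v = c at hc ⊢
  simp only [cycleFold, cycleFoldCount, Fin.ext_iff, s, p]
  clear hset hsp s p
  split_ifs <;> omega

/-- The fold pairs v with 2n-1-v. The paired vertices are adjacent only in the two end cells, {0,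
2n-1} and {n-1, n}, which yields the diagonal ones. The counts are symmetric, so the square root
returns the count itself. -/
theorem isSymmetrizedQuotient_cycleFold {n : ℕ} (hn : 2 ≤ n) :
    IsSymmetrizedQuotient (SimpleGraph.cycleGraph (2 * n)) (cycleFold n) (endPotentialPath n) := by
  refine ⟨fun j => ⟨⟨j, by omega⟩, Fin.ext ?_⟩, cycleFoldCount n,
    fun v k => card_filter_cycleFold hn v k, fun j k => ?_⟩
  · have := j.2
    simp only [cycleFold]
    omega
  · have hsymm : cycleFoldCount n k j = cycleFoldCount n j k := by
      simp only [cycleFoldCount, Fin.ext_iff]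
      split_ifs <;> omega
    rw [hsymm, Real.sqrt_mul_self (Nat.cast_nonneg _), endPotentialPath_apply, cycleFoldCount,
      endPotential]
    push_cast
    rfl

end QWalk
theorem mainTheorem12 (n : ℕ) :
    (QWalk.AdmitsVertexPGST (QWalk.endPotentialPath n) ↔ ∃ k : ℕ, 1 ≤ k ∧ n = 2 ^ k) ∧
    (2 ≤ n → ∃ cell : Fin (2 * n) → Fin n,
      QWalk.IsSymmetrizedQuotient (SimpleGraph.cycleGraph (2 * n)) cell
        (QWalk.endPotentialPath n)) := by
  refine ⟨⟨QWalk.eq_two_pow_of_admitsVertexPGST, ?_⟩, fun hn =>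
    ⟨QWalk.cycleFold n, QWalk.isSymmetrizedQuotient_cycleFold hn⟩⟩
  rintro ⟨k, hk, rfl⟩
  obtain ⟨m, rfl⟩ : ∃ m, k = m + 1 := ⟨k - 1, by omega⟩
  exact QWalk.admitsVertexPGST_two_pow m
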